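/- Let $\mathbb F$ be a field, let $S\in\mathbb F^{N\times N}$ be the shift matrix ($S[i,j]=1$ if $i=j+1$ and $0$ otherwise), and let $Z=S^T$. A matrix $A\in\mathbb F^{N\times N}$ with rows $a_i^T$ ($0\le i<N$) satisfies an *$S$-recurrence of width $(t,r)$ and degree $(\delta,\bar\delta)$* if $$g_{i,0}(S)\,a_i=\sum_{j=1}^{\min(t,i)}g_{i,j}(S)\,a_{i-j}+f_i\qquad(0\le i<N)$$ for polynomials $g_{i,j}\in\mathbb F[X]$ with $\deg g_{i,j}\le \delta j+\bar\delta$ and $g_{i,0}(S)$ invertible, where the matrix with rows $f_i^T$ (the error matrix) has rank at most $r$. Let $m\ge 2$ be even, $d\ge 2$, $N=d^m$, and let $x(1),\dots,x(N)\in\mathbb F^m$. The $m$-variate multipoint evaluation matrix $A^{(m)}\in\mathbb F^{N\times N}$ has columns indexed by $\{0,\dots,d-1\}^m$ in lexicographic order, and its entry in row $k$ and column $(i_1,\dots,i_m)$ is $\prod_j x(k)_j^{i_j}$. Put $$r=2^{m/2}d^{m/2-1},\qquad \Delta=\frac{d^{1+m/2}-1}{d-1}.$$ **(1)** $A^{(m)}$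 satisfies an $S$-recurrence of width $(1,r)$ and degree $(0,\Delta)$. More precisely, suppose that $x(k)_l\ne 0$ for all $k$ and all $m/2\le l\le m$. Put $B^{(m/2+1)}=A^{(m)}$ and $B^{(j)}=D_{X_{m-j}}^{-1}B^{(j+1)}-B^{(j+1)}Z^{d^j}$ for $0\le j\le m/2$, where $D_{X_l}$ is the diagonal matrix with entries $x(1)_l,\dots,x(N)_l$. Then $\operatorname{rank}B^{(0)}\le r$, and $A^{(m)}$ satisfies the recurrence with error matrix $B^{(0)}$, with $g_{k,0}=\prod_{j=0}^{m/2}\bigl(x(k)_{m-j}^{-1}-X^{d^j}\bigr)$ and $g_{k,j}=0$ for $j\ge1$; these polynomials have degree at most $\Delta$ and at most $2^{m/2+1}$ nonzero coefficients. In (2) and (3) an algorithm is an algebraic computation tree over $\mathbb F$, one for each choice of the discrete parameters ($m$, $d$, respectively $N$, $t$, $r$, and the sets of exponents that may occur in the $g_{i,j}$ or the degree bounds), that works for all values of its inputs; its number of operations is the length of its longest branch. $\tilde O(T)$ means at most $K\,T\,(\log (T+2))^{c}$ with constants $K,c$ that do not depend on any of the parameters. *Matrix-vector multiplication* for an $S$-recurrence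 of width $(t,r)$ is the computation of $Ab$ from the $g_{i,j}$, a factorization of the error matrix into an $N\times r$ and an $r\times N$ matrix, and $b$, including all pre-processing. *Multipoint evaluation* is the computation of $f(x(1)),\dots,f(x(N))$ from the coefficients of an $m$-variate polynomial $f$ of degree at most $d-1$ in each variable and $N=d^m$ arbitrary points. **(2)** Suppose that there is a polynomial $p$ such that, for all $N$, $t\ge1$, $r$ and $D\ge 1$, matrix-vector multiplication for the $S$-recurrences of width $(t,r)$ in which every $g_{i,j}$ has at most $D$ nonzero coefficients can be done with $\tilde O(p(t)DN+rN)$ operations. Then multipoint evaluation can be done with $\tilde O\bigl((2d)^{3m/2-1}\bigr)$ operations, for all even $m\ge2$ and all $d\ge2$. This is polynomially better than the bound $O(d^{\omega_2(m-1)/2+1})$, where $O(n^{\omega_2})$ operations suffice to multiply an $n\times n$ by an $n\times n^2$ matrix: for every real $w\ge 3$ and every even $m\ge 2$ there are $\varepsilon>0$ and $K$ such that, for all $d\ge 2$, at most $K d^{w(m-1)/2+1-\varepsilon}$ operations suffice. **(3)** Suppose instead that there is a polynomial $p$ such that, for all $N$, $t\ge1$, $r$ and all $\delta,\bar\delta$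 with $D=\delta+\bar\delta\ge1$, matrix-vector multiplication for the $S$-recurrences of width $(t,r)$ and degree $(\delta,\bar\delta)$ can be done with $\tilde O(p(t)DN+rN)$ operations. Then multipoint evaluation can be done with $\tilde O(\Delta d^m+r d^m)$ operations, for all even $m\ge2$ and all $d\ge2$; and whenever $m\ge 2$ is even and $w$ is a real number with $w(m-1)/2+1>3m/2$, there are $\varepsilon>0$ and $K$ such that, for all $d\ge2$, at most $K d^{w(m-1)/2+1-\varepsilon}$ operations suffice. -/

import Mathlib

open Polynomial Matrix

universe u

noncomputable section

/-! ### Matrices and recurrences -/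

/-- The shift matrix: `S[i,j] = 1` if `i = j + 1`, and `0` otherwise. -/
def shiftMatrix (F : Type u) [Field F] (N : ℕ) : Matrix (Fin N) (Fin N) F :=
  Matrix.of fun i j => if (i : ℕ) = (j : ℕ) + 1 then 1 else 0

/-- The rows `a_i` of `A` satisfy
`g_{i,0}(R) a_i = ∑_{j=1}^{min(t,i)} g_{i,j}(R) a_{i-j} + f_i`,
where `f_i` is the `i`-th row of the error matrix `E`, and every `g_{i,0}(R)` is invertible.
Only the polynomials `g i j` with `j ≤ t` matter. -/
def IsRecurrence {F : Type u} [Field F] {M N : ℕ} (R : Matrix (Fin N) (Fin N) F) (t : ℕ)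
    (g : Fin M → ℕ → F[X]) (E A : Matrix (Fin M) (Fin N) F) : Prop :=
  (∀ i, IsUnit (aeval R (g i 0))) ∧
  ∀ i : Fin M,
    aeval R (g i 0) *ᵥ A i =
      (∑ j ∈ Finset.Icc 1 (min t (i : ℕ)),
        aeval R (g i j) *ᵥ A ⟨(i : ℕ) - j, lt_of_le_of_lt (Nat.sub_le _ _) i.isLt⟩) + E i

/-- `A` satisfies an `R`-recurrence of width `(t, r)` and degree `(δ, δ')`: the error matrix has
rank at most `r`, and `deg g_{i,j} ≤ δ j + δ'`. -/
def SatisfiesRecurrence {F : Type u} [Field F] {M N : ℕ} (R : Matrix (Fin N) (Fin N) F)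
    (t r δ δ' : ℕ) (A : Matrix (Fin M) (Fin N) F) : Prop :=
  ∃ (g : Fin M → ℕ → F[X]) (E : Matrix (Fin M) (Fin N) F),
    IsRecurrence R t g E A ∧ E.rank ≤ r ∧
      ∀ i, ∀ j ≤ t, (g i j).natDegree ≤ δ * j + δ'

/-! ### The multivariate multipoint evaluation matrix

The points are `x k = (x k 0, …, x k (m-1))` for `k < d ^ m`; the variable `X_l` of the usual
numbering from `1` to `m` is the coordinate `l - 1`. -/

/-- The columns are indexed by exponent tuples in `{0, …, d-1}^m` in increasing lexicographic
order, so that column `c` belongs to the tuple of the `m` base-`d` digits of `c`, the most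
significant digit first. -/
def evalMatrix {F : Type u} [Field F] {m d : ℕ} (x : Fin (d ^ m) → Fin m → F) :
    Matrix (Fin (d ^ m)) (Fin (d ^ m)) F :=
  Matrix.of fun k c => ∏ l : Fin m, x k l ^ ((c : ℕ) / d ^ (m - 1 - (l : ℕ)) % d)

/-- One displacement step `B ↦ D⁻¹ B - B Z ^ (d ^ j)`, with `Z = Sᵀ` and `D` the diagonal matrix
of the `(m - j)`-th coordinates (counted from `1`) of the points. -/
def displacementStep {F : Type u} [Field F] {m d : ℕ} (x : Fin (d ^ m) → Fin m → F) (j : Fin m)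
    (B : Matrix (Fin (d ^ m)) (Fin (d ^ m)) F) : Matrix (Fin (d ^ m)) (Fin (d ^ m)) F :=
  Matrix.diagonal (fun k => (x k j.rev)⁻¹) * B - B * (shiftMatrix F (d ^ m))ᵀ ^ (d ^ (j : ℕ))

/-- The matrix `B⁽⁰⁾`, where `B⁽ʲ⁾ = displacementStep x j B⁽ʲ⁺¹⁾` for `0 ≤ j ≤ m/2` and
`B⁽ᵐᐟ²⁺¹⁾ = evalMatrix x`. -/
def displacedMatrix {F : Type u} [Field F] {m d : ℕ} (x : Fin (d ^ m) → Fin m → F) :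
    Matrix (Fin (d ^ m)) (Fin (d ^ m)) F :=
  ((List.finRange m).filter fun j : Fin m => (j : ℕ) ≤ m / 2).foldr (displacementStep x) (evalMatrix x)

/-- The recurrence polynomials: `g_{k,0} = ∏_{0 ≤ j ≤ m/2} (1 / x(k)_{m-j} - X ^ (d ^ j))`, and
`g_{k,j} = 0` for `j ≥ 1`. -/
def evalRecurrencePoly {F : Type u} [Field F] {m d : ℕ} (x : Fin (d ^ m) → Fin m → F)
    (k : Fin (d ^ m)) : ℕ → F[X]
  | 0 => ∏ j ∈ Finset.univ.filter (fun j : Fin m => (j : ℕ) ≤ m / 2),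
      (C (x k j.rev)⁻¹ - X ^ (d ^ (j : ℕ)))
  | _ + 1 => 0

/-! ### Algorithms: algebraic computation trees -/

inductive ArithOp : Type
  | add | sub | mul | div

/-- Algebraic computation trees over `F` with outputs indexed by `κ`, whose current registers are
indexed by `ι`. A step loads a constant or performs an arithmetic operation on two registers, and
puts the result into one new register (`none : Option ι`), or it branches on whether a register
is zero; a leaf names the registers that hold the outputs. -/
inductive CompTree (F : Type u) (κ : Type) : Type → Type (max u 1)
  | ret {ι : Type} (out : κ → ι) : CompTree F κ ι
  | const {ι : Type} (c : F) (next : CompTree F κ (Option ι)) : CompTree F κ ι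
  | op {ι : Type} (o : ArithOp) (a b : ι) (next : CompTree F κ (Option ι)) : CompTree F κ ι
  | test {ι : Type} (a : ι) (ifZero ifNonzero : CompTree F κ ι) : CompTree F κ ι

/-- The value of an operation; division by zero is undefined. -/
def ArithOp.apply {F : Type u} [Field F] : ArithOp → F → F → Option F
  | .add, a, b => some (a + b)
  | .sub, a, b => some (a - b)
  | .mul, a, b => some (a * b)
  | .div, a, b => open Classical in if b = 0 then none else some (a / b)

/-- The outputs of a computation tree on the inputs `env`; `none` if it divides by zero. -/
def CompTree.run {F : Type u} [Field F] {κ : Type} :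
    {ι : Type} → CompTree F κ ι → (ι → F) → Option (κ → F)
  | _, .ret out, env => some fun k => env (out k)
  | _, .const c next, env => next.run fun o => o.elim c env
  | _, .op o a b next, env =>
      (o.apply (env a) (env b)).bind fun v => next.run fun s => s.elim v env
  | _, .test a p q, env => open Classical in if env a = 0 then p.run env else q.run env

/-- The number of steps on a longest branch. -/
def CompTree.cost {F : Type u} {κ : Type} : {ι : Type} → CompTree F κ ι → ℕ
  | _, .ret _ => 0
  | _, .const _ next => next.cost + 1
  | _, .op _ _ _ next => next.cost + 1
  | _, .test _ p q => max p.cost q.cost + 1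

/-- `Õ(T)` with its constants shown: `K · T · (log T)^c`, where `log (T + 2)` replaces `log T` so
that small `T` make sense. -/
def softO (K : ℝ) (c : ℕ) (T : ℝ) : ℝ := K * T * Real.log (T + 2) ^ c

/-! ### Multiplying a matrix given by an `S`-recurrence with a vector -/

/-- The inputs of the multiplication problem: the coefficients of the `g_{i,j}` at the exponents in
`supp i j`, the entries of the factors `C` (`N × r`) and `D` (`r × N`) of the error matrix, and the
entries of the vector. -/
inductive MulInput (N t r : ℕ) (supp : Fin N → Fin (t + 1) → Finset ℕ) : Type
  | coeff (i : Fin N) (j : Fin (t + 1)) (e : ℕ) (he : e ∈ supp i j)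
  | left (i : Fin N) (k : Fin r)
  | right (k : Fin r) (i : Fin N)
  | vec (i : Fin N)

def MulInput.value {F : Type u} [Field F] {N t r : ℕ} {supp : Fin N → Fin (t + 1) → Finset ℕ}
    (g : Fin N → ℕ → F[X]) (C : Matrix (Fin N) (Fin r) F) (D : Matrix (Fin r) (Fin N) F)
    (b : Fin N → F) : MulInput N t r supp → F
  | .coeff i j e _ => (g i j).coeff e
  | .left i k => C i k
  | .right k i => D k i
  | .vec i => b i

/-- The tree computes `A b` from the `g_{i,j}`, `C`, `D` and `b`, for every `b` and every `A` that
satisfies an `S`-recurrence with error matrix `C D` and `g_{i,j}` supported in `supp i j`. -/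
def Multiplies {F : Type u} [Field F] {N t r : ℕ} {supp : Fin N → Fin (t + 1) → Finset ℕ}
    (P : CompTree F (Fin N) (MulInput N t r supp)) : Prop :=
  ∀ (g : Fin N → ℕ → F[X]) (C : Matrix (Fin N) (Fin r) F) (D : Matrix (Fin r) (Fin N) F)
    (A : Matrix (Fin N) (Fin N) F) (b : Fin N → F),
    (∀ (i : Fin N) (j : Fin (t + 1)), (g i j).support ⊆ supp i j) →
    IsRecurrence (shiftMatrix F N) t g (C * D) A →
    P.run (MulInput.value g C D b) = some (A *ᵥ b)

/-- `S`-recurrences of width `(t, r)` all of whose polynomials have at most `D` nonzero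
coefficients admit matrix-vector multiplication with `Õ(poly(t) · D N + r N)` operations. -/
def FastSparseMultiplication (F : Type u) [Field F] : Prop :=
  ∃ (p : ℕ[X]) (K : ℝ) (c : ℕ), ∀ (N t r D : ℕ) (supp : Fin N → Fin (t + 1) → Finset ℕ),
    1 ≤ t → 1 ≤ D → (∀ i j, (supp i j).card ≤ D) →
    ∃ P : CompTree F (Fin N) (MulInput N t r supp), Multiplies P ∧
      (P.cost : ℝ) ≤ softO K c ((p.eval t * D * N + r * N : ℕ) : ℝ)

/-- `S`-recurrences of width `(t, r)` and degree `(δ, δ')` admit matrix-vector multiplication with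
`Õ(poly(t) · D N + r N)` operations, where `D = δ + δ'`. -/
def FastDegreeMultiplication (F : Type u) [Field F] : Prop :=
  ∃ (p : ℕ[X]) (K : ℝ) (c : ℕ), ∀ (N t r δ δ' : ℕ),
    1 ≤ t → 1 ≤ δ + δ' →
    ∃ P : CompTree F (Fin N)
        (MulInput N t r fun _ j => Finset.range (δ * (j : ℕ) + δ' + 1)), Multiplies P ∧
      (P.cost : ℝ) ≤ softO K c ((p.eval t * (δ + δ') * N + r * N : ℕ) : ℝ)

/-! ### Multivariate multipoint evaluation -/

/-- The inputs of multipoint evaluation: the coefficients of an `m`-variate polynomial with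
individual degrees less than `d`, and the coordinates of `d ^ m` points. -/
inductive EvalInput (m d : ℕ) : Type
  | coeff (e : Fin m → Fin d)
  | coord (k : Fin (d ^ m)) (l : Fin m)

def EvalInput.value {F : Type u} [Field F] {m d : ℕ} (f : MvPolynomial (Fin m) F)
    (x : Fin (d ^ m) → Fin m → F) : EvalInput m d → F
  | .coeff e => f.coeff (Finsupp.equivFunOnFinite.symm fun l => (e l : ℕ))
  | .coord k l => x k l

/-- `m`-variate multipoint evaluation of polynomials with individual degrees at most `d - 1`, at
`d ^ m` arbitrary points (which need not be distinct), can be done with at most `T` operations. -/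
def MultipointEvaluationWithin (F : Type u) [Field F] (m d : ℕ) (T : ℝ) : Prop :=
  ∃ P : CompTree F (Fin (d ^ m)) (EvalInput m d),
    (∀ (f : MvPolynomial (Fin m) F) (x : Fin (d ^ m) → Fin m → F),
      (∀ l, f.degreeOf l < d) →
      P.run (EvalInput.value f x) = some fun k => MvPolynomial.eval (x k) f) ∧
    (P.cost : ℝ) ≤ T

end

/-! Put `y_j = x(k)_{m-j}`. By uniqueness of base-`d` digits, row `k` of the evaluation matrix is
the coefficient vector of `∏_{j<m} ∑_{i<d} (y_j X^(d^j))^i` (`evalMatrix_row`), and `S` acts on such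
vectors as multiplication by `X` modulo `X^N` (`aeval_shiftMatrix_mulVec`). Multiplication by
`∏_{j≤m/2} (1 - y_j X^(d^j))` telescopes the first `m/2+1` geometric sums into `1 - y_j^d
X^(d^(j+1))`. The factor with `j = m/2` is a polynomial in `X^(d^(m/2+1))` and joins the high
digits. The other `m/2` factors produce at most `2^(m/2)` exponents, all below `d^(m/2+1)`, while
the high digits take `d^(m/2-1)` values. The error therefore lives in at most `r` columns that do
not depend on the points (`errorMatrix_apply`, `exists_errorMatrix_eq`). This bounds the rank and
gives an explicit factorization. The polynomials with `1/x - X^(d^j)` differ only by nonzero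
scalars, so `B⁽⁰⁾` is a row rescaling of this error matrix.

For the algorithms, the form `1 - y X^(d^j)` needs no division and tolerates zero coordinates. Every
input of the multiplication problem costs `O(m log d)` operations, after which the assumed tree is
run on them (`exists_evaluation_tree`). Since `d^m ≤ T`, the factor `m log d` is `O(log T)` and
disappears in `Õ(T)` (`exists_softO_bound`). For fixed `m` the exponents differ by a positive
amount, which absorbs all logarithms (`exists_rpow_bound`). -/

/-! ### The shift matrix acts on coefficient vectors by multiplication -/

section Shift

variable {F : Type u} [Field F] {N : ℕ}

/-- The first `N` coefficients of a polynomial. -/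
def coeffVec (N : ℕ) (P : F[X]) : Fin N → F := fun c => P.coeff c

theorem coeffVec_add (P Q : F[X]) : coeffVec N (P + Q) = coeffVec N P + coeffVec N Q := by
  ext c; simp [coeffVec]

theorem coeffVec_C_mul (a : F) (P : F[X]) : coeffVec N (C a * P) = a • coeffVec N P := by
  ext c; simp [coeffVec]

theorem exists_coeffVec_eq (v : Fin N → F) : ∃ P : F[X], coeffVec N P = v := by
  refine ⟨∑ c : Fin N, monomial (c : ℕ) (v c), ?_⟩
  ext c
  simp [coeffVec, coeff_monomial, Fin.val_inj]

theorem shiftMatrix_mulVec_coeffVec (P : F[X]) :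
    shiftMatrix F N *ᵥ coeffVec N P = coeffVec N (X * P) := by
  ext ⟨c, hc⟩
  simp only [mulVec, dotProduct, shiftMatrix, of_apply, coeffVec, ite_mul, one_mul, zero_mul]
  cases c with
  | zero => simp
  | succ n =>
    rw [coeff_X_mul, Finset.sum_eq_single (⟨n, by omega⟩ : Fin N)]
    · simp
    · intro b _ hb
      rw [if_neg]
      intro h
      exact hb (Fin.ext (by simp; omega))
    · simp

theorem aeval_shiftMatrix_mulVec (g P : F[X]) :
    aeval (shiftMatrix F N) g *ᵥ coeffVec N P = coeffVec N (g * P) := by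
  induction g using Polynomial.induction_on generalizing P with
  | C a => simp [Algebra.algebraMap_eq_smul_one, smul_mulVec, coeffVec_C_mul]
  | add p q hp hq => rw [map_add, add_mulVec, hp, hq, add_mul, coeffVec_add]
  | monomial n a ih =>
    rw [pow_succ, ← mul_assoc, map_mul, aeval_X, ← mulVec_mulVec, shiftMatrix_mulVec_coeffVec, ih,
      mul_assoc (C a * X ^ n)]

theorem isNilpotent_shiftMatrix : IsNilpotent (shiftMatrix F N) := by
  refine ⟨N, ?_⟩
  refine ext_of_mulVec_single fun i => ?_
  obtain ⟨P, hP⟩ := exists_coeffVec_eq (Pi.single i (1 : F))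
  have h := aeval_shiftMatrix_mulVec (N := N) (X ^ N) P
  rw [map_pow, aeval_X, hP] at h
  rw [h, zero_mulVec]
  ext c
  simp [coeffVec, coeff_X_pow_mul', c.isLt]

/-- Splitting off the constant term writes `g(a)` as a unit plus a nilpotent element commuting with
it. Invertibility of `g_{i,0}(S)` thus reduces to a nonzero constant term. -/
theorem isUnit_aeval_of_isNilpotent {A : Type*} [Ring A] [Algebra F A] {a : A}
    (ha : IsNilpotent a) {g : F[X]} (hg : g.coeff 0 ≠ 0) : IsUnit (aeval a g) := by
  have h : aeval a g = a * aeval a g.divX + algebraMap F A (g.coeff 0) := by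
    have h := congrArg (aeval a) (X_mul_divX_add g).symm
    rwa [map_add, map_mul, aeval_X, aeval_C] at h
  have hc : Commute a (aeval a g.divX) := by
    have := Commute.map (Commute.all (X : F[X]) g.divX) (aeval a)
    simpa using this
  rw [h]
  exact (Commute.isNilpotent_mul_right hc ha).isUnit_add_right_of_commute
    ((IsUnit.mk0 _ hg).map (algebraMap F A)) (Algebra.commutes _ _).symm

end Shift

/-! ### Coefficients of products of sparse polynomials -/

section Coeff

variable {F : Type u} [Field F]

/-- An exponent of the product is `u + M v` with `u < M`. There are no carries, so `u` and `v` are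
the remainder and quotient of `c` modulo `M`. -/
theorem coeff_mul_expand {M : ℕ} {P : F[X]} (hP : P.natDegree < M) (Q : F[X]) (c : ℕ) :
    (P * expand F M Q).coeff c = P.coeff (c % M) * Q.coeff (c / M) := by
  have hM : 0 < M := by omega
  induction Q using Polynomial.induction_on' with
  | add p q hp hq => simp only [map_add, mul_add, coeff_add, hp, hq]
  | monomial n a =>
    rw [expand_monomial, ← C_mul_X_pow_eq_monomial, ← C_mul_X_pow_eq_monomial, ← mul_assoc,
      coeff_mul_X_pow', coeff_mul_C, coeff_C_mul, coeff_X_pow]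
    by_cases h : c / M = n
    · have h2 := Nat.div_add_mod c M
      have h3 : c - n * M = c % M := by rw [h, mul_comm] at h2; omega
      have h4 : n * M ≤ c := by rw [h, mul_comm] at h2; omega
      simp [h, h3, h4]
    · rw [if_neg h, mul_zero, mul_zero]
      split_ifs with hle
      · rw [coeff_eq_zero_of_natDegree_lt, zero_mul]
        have h1 : n ≤ c / M := (Nat.le_div_iff_mul_le hM).2 hle
        have h2 : (n + 1) * M ≤ c :=
          (Nat.le_div_iff_mul_le hM).1 (by omega)
        rw [add_mul] at h2
        omega
      · rfl

/-- `∏_{j < n} ∑_{i < d} y_j ^ i X ^ (i d ^ j)`: the generating function of the monomials in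
`y_0, …, y_{n-1}` with exponents below `d`. -/
noncomputable def digitPoly (d n : ℕ) (y : ℕ → F) : F[X] :=
  ∏ j ∈ Finset.range n, ∑ i ∈ Finset.range d, (C (y j) * X ^ d ^ j) ^ i

/-- `∏_{j < n} (1 - y_j X ^ (d ^ j))`. -/
noncomputable def annihilator (d n : ℕ) (y : ℕ → F) : F[X] :=
  ∏ j ∈ Finset.range n, (1 - C (y j) * X ^ d ^ j)

variable {d : ℕ}

theorem natDegree_geomSum_lt (hd : 0 < d) (a : F) :
    (∑ i ∈ Finset.range d, (C a * X) ^ i).natDegree < d := by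
  refine lt_of_le_of_lt (natDegree_sum_le_of_forall_le (n := d - 1) _ _ fun i hi => ?_) (by omega)
  rw [mul_pow, ← C_pow]
  have := Finset.mem_range.1 hi
  exact (natDegree_C_mul_X_pow_le _ _).trans (by omega)

theorem coeff_geomSum (a : F) {c : ℕ} (hc : c < d) :
    (∑ i ∈ Finset.range d, (C a * X) ^ i).coeff c = a ^ c := by
  simp only [mul_pow, ← C_pow, finsetSum_coeff, coeff_C_mul, coeff_X_pow, mul_ite, mul_one,
    mul_zero]
  rw [Finset.sum_ite_eq, if_pos (Finset.mem_range.2 hc)]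

theorem digitPoly_succ (d n : ℕ) (y : ℕ → F) :
    digitPoly d (n + 1) y =
      digitPoly d n y * expand F (d ^ n) (∑ i ∈ Finset.range d, (C (y n) * X) ^ i) := by
  rw [digitPoly, Finset.prod_range_succ, ← digitPoly]
  simp

theorem natDegree_digitPoly_lt (hd : 0 < d) (n : ℕ) (y : ℕ → F) :
    (digitPoly d n y).natDegree < d ^ n := by
  induction n with
  | zero => simp [digitPoly]
  | succ n ih =>
    rw [digitPoly_succ]
    refine lt_of_le_of_lt natDegree_mul_le ?_
    rw [natDegree_expand]
    have h := natDegree_geomSum_lt hd (y n)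
    have h2 : (∑ i ∈ Finset.range d, (C (y n) * X) ^ i).natDegree * d ^ n ≤ (d - 1) * d ^ n :=
      Nat.mul_le_mul_right _ (by omega)
    have h3 : d ^ (n + 1) = (d - 1) * d ^ n + d ^ n := by
      obtain ⟨e, rfl⟩ : ∃ e, d = e + 1 := ⟨d - 1, by omega⟩
      rw [Nat.add_sub_cancel]; ring
    omega

theorem coeff_digitPoly (hd : 0 < d) (n : ℕ) (y : ℕ → F) {c : ℕ} (hc : c < d ^ n) :
    (digitPoly d n y).coeff c = ∏ j ∈ Finset.range n, y j ^ (c / d ^ j % d) := by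
  induction n generalizing c with
  | zero =>
    obtain rfl : c = 0 := by simpa using hc
    simp [digitPoly]
  | succ n ih =>
    have hq : c / d ^ n < d := by
      rw [Nat.div_lt_iff_lt_mul (by positivity), ← pow_succ']; exact hc
    rw [digitPoly_succ, coeff_mul_expand (natDegree_digitPoly_lt hd n y), coeff_geomSum _ hq,
      ih (Nat.mod_lt _ (by positivity)), Finset.prod_range_succ, Nat.mod_eq_of_lt hq]
    congr 1
    -- Reduction modulo `d^n` leaves the digits at positions below `n` unchanged.
    refine Finset.prod_congr rfl fun j hj => ?_
    have hj := Finset.mem_range.1 hj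
    obtain ⟨k, rfl⟩ : ∃ k, n = j + (k + 1) := ⟨n - j - 1, by omega⟩
    rw [pow_add, Nat.mod_mul_right_div_self, Nat.mod_mod_of_dvd _ (dvd_pow_self d (by omega))]

/-- With `z = y_j X^(d^j)`, each factor is `(1 - z)(1 + z + … + z^(d-1)) = 1 - z^d`. -/
theorem annihilator_mul_digitPoly (d n : ℕ) (y : ℕ → F) :
    annihilator d n y * digitPoly d n y = expand F d (annihilator d n fun j => y j ^ d) := by
  rw [annihilator, digitPoly, ← Finset.prod_mul_distrib, annihilator, map_prod]
  refine Finset.prod_congr rfl fun j _ => ?_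
  rw [mul_neg_geom_sum, map_sub, map_one, map_mul, expand_C, map_pow (expand F d), expand_X, mul_pow,
    ← C_pow, ← pow_mul, ← pow_mul, mul_comm d]

/-- The telescoped factor with index `n` involves only `X^(d^(n+1))`, so it is grouped with the
untouched high factors. The low part keeps `n` rather than `n + 1` factors, which halves the bound
on its number of exponents. -/
theorem annihilator_mul_digitPoly_add (d n k : ℕ) (y : ℕ → F) :
    annihilator d (n + 1) y * digitPoly d (n + 1 + k) y =
      expand F d (annihilator d n fun j => y j ^ d) *
        expand F (d ^ (n + 1))
          ((1 - C (y n ^ d) * X) * digitPoly d k fun j => y (n + 1 + j)) := by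
  have h : digitPoly d (n + 1 + k) y =
      digitPoly d (n + 1) y * expand F (d ^ (n + 1)) (digitPoly d k fun j => y (n + 1 + j)) := by
    rw [digitPoly, Finset.prod_range_add, ← digitPoly]
    congr 1
    rw [digitPoly, map_prod]
    refine Finset.prod_congr rfl fun j _ => ?_
    simp [← pow_mul, pow_add]
  rw [h, ← mul_assoc, annihilator_mul_digitPoly, annihilator, Finset.prod_range_succ,
    ← annihilator, map_mul, map_mul, mul_assoc]
  simp [← pow_mul, pow_succ, mul_comm]

theorem annihilator_eq_sum (d n : ℕ) (y : ℕ → F) :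
    annihilator d n y = ∑ J ∈ (Finset.range n).powerset,
      C (∏ j ∈ J, -y j) * X ^ ∑ j ∈ J, d ^ j := by
  rw [annihilator]
  simp only [sub_eq_neg_add]
  rw [Finset.prod_add_one]
  refine Finset.sum_congr rfl fun J _ => ?_
  rw [map_prod, ← Finset.prod_pow_eq_pow_sum, ← Finset.prod_mul_distrib]
  simp

/-- For `d ≥ 2`, distinct sets `J` have distinct sums, so no terms merge. Each coefficient is a
single product and hence cheap to compute. -/
theorem coeff_annihilator_sum (hd : 2 ≤ d) {n : ℕ} (y : ℕ → F) {J : Finset ℕ}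
    (hJ : J ⊆ Finset.range n) :
    (annihilator d n y).coeff (∑ j ∈ J, d ^ j) = ∏ j ∈ J, -y j := by
  rw [annihilator_eq_sum, finsetSum_coeff, Finset.sum_eq_single J]
  · rw [coeff_C_mul, coeff_X_pow, if_pos rfl, mul_one]
  · intro K _ hK
    rw [coeff_C_mul, coeff_X_pow, if_neg, mul_zero]
    exact fun h => hK (Finset.geomSum_injective hd h).symm
  · exact fun h => absurd (Finset.mem_powerset.2 hJ) h

/-- The sums `∑_{j ∈ J} d ^ j` with `J ⊆ {0, …, n-1}`. -/
def powSums (d n : ℕ) : Finset ℕ :=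
  (Finset.range n).powerset.image fun J => ∑ j ∈ J, d ^ j

theorem card_powSums_le (d n : ℕ) : (powSums d n).card ≤ 2 ^ n :=
  Finset.card_image_le.trans (by simp)

theorem support_annihilator_subset (d n : ℕ) (y : ℕ → F) :
    (annihilator d n y).support ⊆ powSums d n := by
  intro e he
  rw [annihilator_eq_sum, mem_support_iff, finsetSum_coeff] at he
  obtain ⟨J, hJ, h⟩ := Finset.exists_ne_zero_of_sum_ne_zero he
  refine Finset.mem_image.2 ⟨J, hJ, ?_⟩
  by_contra hne
  rw [coeff_C_mul, coeff_X_pow, if_neg (fun h => hne h.symm), mul_zero] at h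
  exact h rfl

theorem natDegree_annihilator_le (hd : 2 ≤ d) (n : ℕ) (y : ℕ → F) :
    (annihilator d n y).natDegree ≤ (d ^ n - 1) / (d - 1) := by
  rw [← Nat.geomSum_eq hd, annihilator]
  refine (natDegree_prod_le _ _).trans (Finset.sum_le_sum fun j _ => ?_)
  refine (natDegree_sub_le _ _).trans ?_
  simpa using natDegree_C_mul_X_pow_le (y j) (d ^ j)

/-- This is the degree condition under which `coeff_mul_expand` separates the low digits from the
high ones. -/
theorem natDegree_expand_annihilator_lt (hd : 2 ≤ d) (n : ℕ) (y : ℕ → F) :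
    (expand F d (annihilator d n y)).natDegree < d ^ (n + 1) := by
  rw [natDegree_expand, pow_succ]
  refine Nat.mul_lt_mul_of_pos_right ?_ (by omega)
  refine (natDegree_annihilator_le hd n y).trans_lt ?_
  rw [← Nat.geomSum_eq hd]
  exact Nat.geomSum_lt hd fun k hk => Finset.mem_range.1 hk

theorem coeff_zero_annihilator (hd : 2 ≤ d) (n : ℕ) (y : ℕ → F) :
    (annihilator d n y).coeff 0 = 1 := by
  simpa using coeff_annihilator_sum hd y (Finset.empty_subset (Finset.range n))

end Coeff

/-! ### The recurrence of the evaluation matrix -/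

section Recurrence

variable {F : Type u} [Field F] {m d : ℕ}

/-- The coordinates of a point, numbered from the last one on, and extended by zero. -/
def revCoord (v : Fin m → F) (j : ℕ) : F := if h : j < m then v (Fin.rev ⟨j, h⟩) else 0

theorem revCoord_val (v : Fin m → F) (j : Fin m) : revCoord v j = v j.rev := by
  simp [revCoord]

theorem evalMatrix_row (hd : 0 < d) (x : Fin (d ^ m) → Fin m → F) (k : Fin (d ^ m)) :
    evalMatrix x k = coeffVec (d ^ m) (digitPoly d m (revCoord (x k))) := by
  ext c
  rw [coeffVec, coeff_digitPoly hd _ _ c.isLt, Finset.prod_range,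
    ← Equiv.prod_comp Fin.revPerm]
  simp only [evalMatrix, of_apply, revCoord_val, Fin.revPerm_apply, Fin.rev_rev]
  refine Finset.prod_congr rfl fun l _ => ?_
  rw [Fin.val_rev, Nat.sub_sub, add_comm 1]

/-- The error matrix of the recurrence with the polynomials `∏_{j ≤ m/2} (1 - x_{m-j} X ^ (d ^ j))`,
which are meaningful whether or not coordinates vanish. -/
noncomputable def errorMatrix (x : Fin (d ^ m) → Fin m → F) :
    Matrix (Fin (d ^ m)) (Fin (d ^ m)) F :=
  Matrix.of fun k => coeffVec (d ^ m)
    (annihilator d (m / 2 + 1) (revCoord (x k)) * digitPoly d m (revCoord (x k)))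

/-- The recurrence polynomials that belong to `errorMatrix`. -/
noncomputable def annihilatorPoly (x : Fin (d ^ m) → Fin m → F) (k : Fin (d ^ m)) (j : ℕ) : F[X] :=
  if j = 0 then annihilator d (m / 2 + 1) (revCoord (x k)) else 0

theorem isRecurrence_one_iff {M N : ℕ} {R : Matrix (Fin N) (Fin N) F} {g : Fin M → ℕ → F[X]}
    {E A : Matrix (Fin M) (Fin N) F} (hg : ∀ i, g i 1 = 0) :
    IsRecurrence R 1 g E A ↔
      (∀ i, IsUnit (aeval R (g i 0))) ∧ ∀ i, aeval R (g i 0) *ᵥ A i = E i := by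
  refine and_congr_right fun _ => forall_congr' fun i => ?_
  rw [Finset.sum_eq_zero, zero_add]
  intro j hj
  obtain rfl : j = 1 := by
    have := Finset.mem_Icc.1 hj
    omega
  rw [hg, map_zero, zero_mulVec]

theorem aeval_annihilator_mulVec_evalMatrix (hd : 0 < d) (x : Fin (d ^ m) → Fin m → F)
    (k : Fin (d ^ m)) :
    aeval (shiftMatrix F (d ^ m)) (annihilator d (m / 2 + 1) (revCoord (x k))) *ᵥ evalMatrix x k =
      errorMatrix x k := by
  rw [evalMatrix_row hd, aeval_shiftMatrix_mulVec]
  rfl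

theorem isRecurrence_errorMatrix (hd : 2 ≤ d) (x : Fin (d ^ m) → Fin m → F) :
    IsRecurrence (shiftMatrix F (d ^ m)) 1 (annihilatorPoly x) (errorMatrix x) (evalMatrix x) := by
  rw [isRecurrence_one_iff fun i => by simp [annihilatorPoly]]
  simp only [annihilatorPoly, if_true]
  refine ⟨fun i => isUnit_aeval_of_isNilpotent isNilpotent_shiftMatrix ?_,
    aeval_annihilator_mulVec_evalMatrix (by omega) x⟩
  rw [coeff_zero_annihilator hd]
  exact one_ne_zero

theorem errorMatrix_apply (hd : 2 ≤ d) (hm : Even m) (hm2 : 2 ≤ m) (x : Fin (d ^ m) → Fin m → F)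
    (k c : Fin (d ^ m)) :
    errorMatrix x k c =
      (if d ∣ c % d ^ (m / 2 + 1) then
        (annihilator d (m / 2) fun j => revCoord (x k) j ^ d).coeff (c % d ^ (m / 2 + 1) / d)
      else 0) *
      ((1 - C (revCoord (x k) (m / 2) ^ d) * X) *
        digitPoly d (m / 2 - 1) fun j => revCoord (x k) (m / 2 + 1 + j)).coeff
          (c / d ^ (m / 2 + 1)) := by
  have h : m = m / 2 + 1 + (m / 2 - 1) := by
    obtain ⟨n, rfl⟩ := hm; omega
  have h2 : digitPoly d m (revCoord (x k)) =
      digitPoly d (m / 2 + 1 + (m / 2 - 1)) (revCoord (x k)) := by rw [← h]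
  rw [errorMatrix, of_apply, coeffVec, h2, annihilator_mul_digitPoly_add, coeff_mul_expand
    (natDegree_expand_annihilator_lt hd _ _), coeff_expand (by omega)]

/-- The columns in which the error matrix can be nonzero. -/
def errorColumns (m d : ℕ) : Finset ℕ :=
  (powSums d (m / 2) ×ˢ Finset.range (d ^ (m / 2 - 1))).image fun p =>
    d ^ (m / 2 + 1) * p.2 + d * p.1

theorem card_errorColumns_le (m d : ℕ) :
    (errorColumns m d).card ≤ 2 ^ (m / 2) * d ^ (m / 2 - 1) := by
  refine Finset.card_image_le.trans ?_
  rw [Finset.card_product, Finset.card_range]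
  exact Nat.mul_le_mul_right _ (card_powSums_le _ _)

theorem div_pow_half_lt (hm : Even m) (hm2 : 2 ≤ m) {c : ℕ} (hc : c < d ^ m) :
    c / d ^ (m / 2 + 1) < d ^ (m / 2 - 1) := by
  have h : m = m / 2 - 1 + (m / 2 + 1) := by
    obtain ⟨n, rfl⟩ := hm; omega
  have hd : 0 < d := Nat.pos_of_ne_zero fun h0 => by
    rw [h0, zero_pow (by omega)] at hc; omega
  rw [Nat.div_lt_iff_lt_mul (by positivity), ← pow_add, ← h]
  exact hc

theorem mem_errorColumns (hd : 2 ≤ d) (hm : Even m) (hm2 : 2 ≤ m) (x : Fin (d ^ m) → Fin m → F)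
    {k c : Fin (d ^ m)} (h : errorMatrix x k c ≠ 0) : (c : ℕ) ∈ errorColumns m d := by
  rw [errorMatrix_apply hd hm hm2] at h
  have h1 := left_ne_zero_of_mul h
  split_ifs at h1 with hdvd
  · refine Finset.mem_image.2 ⟨((c : ℕ) % d ^ (m / 2 + 1) / d, (c : ℕ) / d ^ (m / 2 + 1)),
      Finset.mem_product.2 ⟨support_annihilator_subset _ _ _ (mem_support_iff.2 h1),
        Finset.mem_range.2 (div_pow_half_lt hm hm2 c.isLt)⟩, ?_⟩
    rw [Nat.mul_div_cancel' hdvd, Nat.div_add_mod]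
  · exact absurd rfl h1

/-- The matrix that selects the columns `σ 0, …, σ (r-1)`. -/
def selector (F : Type u) [Field F] {N r : ℕ} (σ : Fin r → Fin N) : Matrix (Fin r) (Fin N) F :=
  Matrix.of fun s c => if c = σ s then 1 else 0

theorem submatrix_mul_selector {M N r : ℕ} {σ : Fin r → Fin N} (hσ : Function.Injective σ)
    {E : Matrix (Fin M) (Fin N) F} (hE : ∀ k c, c ∉ Set.range σ → E k c = 0) :
    E.submatrix id σ * selector F σ = E := by
  ext k c
  rw [mul_apply]
  simp only [submatrix_apply, id, selector, of_apply, mul_ite, mul_one, mul_zero]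
  by_cases hc : c ∈ Set.range σ
  · obtain ⟨s, rfl⟩ := hc
    simp [hσ.eq_iff]
  · rw [hE k c hc]
    exact Finset.sum_eq_zero fun s _ => if_neg fun h => hc ⟨s, h.symm⟩

/-- One `σ` serves all points, so the right factor consists of constants and the left factor of
entries of the error matrix: no rank factorization has to be computed. -/
theorem exists_errorMatrix_eq (F : Type u) [Field F] (hd : 2 ≤ d) (hm : Even m) (hm2 : 2 ≤ m) :
    ∃ σ : Fin (2 ^ (m / 2) * d ^ (m / 2 - 1)) → Fin (d ^ m),
      ∀ x : Fin (d ^ m) → Fin m → F,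
        (errorMatrix x).submatrix id σ * selector F σ = errorMatrix x := by
  have hle : 2 ^ (m / 2) * d ^ (m / 2 - 1) ≤ d ^ m := by
    calc 2 ^ (m / 2) * d ^ (m / 2 - 1) ≤ d ^ (m / 2) * d ^ (m / 2 - 1) := by gcongr
      _ = d ^ (m / 2 + (m / 2 - 1)) := (pow_add _ _ _).symm
      _ ≤ d ^ m := Nat.pow_le_pow_right (by omega) (by omega)
  have hcard : (Finset.univ.filter fun c : Fin (d ^ m) => (c : ℕ) ∈ errorColumns m d).card ≤
      2 ^ (m / 2) * d ^ (m / 2 - 1) := by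
    refine le_trans ?_ (card_errorColumns_le m d)
    refine Finset.card_le_card_of_injOn (fun c => (c : ℕ)) (fun c hc => ?_)
      (fun a _ b _ h => Fin.ext h)
    exact (Finset.mem_filter.1 hc).2
  -- There may be fewer than `r` relevant columns. The set is padded to exactly `r`, which is
  -- possible because `r ≤ N`.
  obtain ⟨T, hT, hTc⟩ := Finset.exists_superset_card_eq hcard (by simpa using hle)
  refine ⟨T.orderEmbOfFin hTc, fun x =>
    submatrix_mul_selector (T.orderEmbOfFin hTc).injective fun k c hc => ?_⟩
  by_contra hne
  rw [Finset.range_orderEmbOfFin] at hc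
  exact hc (hT (Finset.mem_filter.2 ⟨Finset.mem_univ _, mem_errorColumns hd hm hm2 x hne⟩))

theorem rank_errorMatrix_le (hd : 2 ≤ d) (hm : Even m) (hm2 : 2 ≤ m)
    (x : Fin (d ^ m) → Fin m → F) :
    (errorMatrix x).rank ≤ 2 ^ (m / 2) * d ^ (m / 2 - 1) := by
  obtain ⟨σ, hσ⟩ := exists_errorMatrix_eq F hd hm hm2
  rw [← hσ x]
  refine (rank_mul_le_left _ _).trans ((rank_le_card_width _).trans ?_)
  simp

theorem satisfiesRecurrence_evalMatrix (hd : 2 ≤ d) (hm : Even m) (hm2 : 2 ≤ m)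
    (x : Fin (d ^ m) → Fin m → F) :
    SatisfiesRecurrence (shiftMatrix F (d ^ m)) 1 (2 ^ (m / 2) * d ^ (m / 2 - 1))
      0 ((d ^ (1 + m / 2) - 1) / (d - 1)) (evalMatrix x) := by
  refine ⟨annihilatorPoly x, errorMatrix x, isRecurrence_errorMatrix hd x,
    rank_errorMatrix_le hd hm hm2 x, fun k j _ => ?_⟩
  rw [zero_mul, zero_add, annihilatorPoly, add_comm 1]
  split_ifs
  · exact natDegree_annihilator_le hd _ _
  · simp

/-! ### The displaced matrix -/

/-- Right multiplication by `Z = Sᵀ` applies `S` to each row regarded as a column vector. -/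
theorem displacementStep_row (x : Fin (d ^ m) → Fin m → F) (j : Fin m)
    (B : Matrix (Fin (d ^ m)) (Fin (d ^ m)) F) (k : Fin (d ^ m)) :
    displacementStep x j B k =
      aeval (shiftMatrix F (d ^ m)) (C (x k j.rev)⁻¹ - X ^ d ^ (j : ℕ)) *ᵥ B k := by
  have h : (B * (shiftMatrix F (d ^ m))ᵀ ^ d ^ (j : ℕ)) k =
      (shiftMatrix F (d ^ m) ^ d ^ (j : ℕ)) *ᵥ B k := by
    rw [← transpose_pow, ← vecMul_transpose]
    rfl
  have h2 : displacementStep x j B k =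
      (x k j.rev)⁻¹ • B k - (B * (shiftMatrix F (d ^ m))ᵀ ^ d ^ (j : ℕ)) k := by
    ext c
    simp [displacementStep]
  rw [h2, h]
  simp [sub_mulVec, Algebra.algebraMap_eq_smul_one, smul_mulVec]

theorem foldr_displacementStep_row (x : Fin (d ^ m) → Fin m → F) (l : List (Fin m))
    (B : Matrix (Fin (d ^ m)) (Fin (d ^ m)) F) (k : Fin (d ^ m)) :
    l.foldr (displacementStep x) B k =
      aeval (shiftMatrix F (d ^ m))
        (l.map fun j : Fin m => C (x k j.rev)⁻¹ - X ^ d ^ (j : ℕ)).prod *ᵥ B k := by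
  induction l with
  | nil => simp
  | cons j l ih =>
    rw [List.foldr_cons, displacementStep_row, ih, mulVec_mulVec, List.map_cons, List.prod_cons,
      map_mul]

theorem displacedMatrix_row (x : Fin (d ^ m) → Fin m → F) (k : Fin (d ^ m)) :
    displacedMatrix x k =
      aeval (shiftMatrix F (d ^ m)) (evalRecurrencePoly x k 0) *ᵥ evalMatrix x k := by
  rw [displacedMatrix, foldr_displacementStep_row, evalRecurrencePoly,
    ← List.prod_toFinset _ ((List.nodup_finRange m).filter _), List.toFinset_filter,
    List.toFinset_finRange]
  simp

theorem prod_filter_val_le {M : Type*} [CommMonoid M] {h : ℕ} (hh : h < m) (f : ℕ → M) :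
    ∏ j ∈ Finset.univ.filter (fun j : Fin m => (j : ℕ) ≤ h), f j =
      ∏ j ∈ Finset.range (h + 1), f j := by
  have : Finset.range (h + 1) =
      (Finset.univ.filter (fun j : Fin m => (j : ℕ) ≤ h)).map Fin.valEmbedding := by
    ext j
    simp only [Finset.mem_range, Finset.mem_map, Finset.mem_filter, Finset.mem_univ, true_and,
      Fin.valEmbedding_apply]
    exact ⟨fun hj => ⟨⟨j, by omega⟩, by simp; omega, rfl⟩, fun ⟨a, ha, hj⟩ => by omega⟩
  rw [this, Finset.prod_map]
  rfl

/-- Each factor is `x⁻¹ - X^(d^j) = x⁻¹ (1 - x X^(d^j))`; the scalars `x⁻¹` are collected in `a`. -/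
theorem evalRecurrencePoly_zero (hm2 : 2 ≤ m) {x : Fin (d ^ m) → Fin m → F} {k : Fin (d ^ m)}
    (hx : ∀ j : Fin m, (j : ℕ) ≤ m / 2 → x k j.rev ≠ 0) :
    ∃ a : F, a ≠ 0 ∧
      evalRecurrencePoly x k 0 = C a * annihilator d (m / 2 + 1) (revCoord (x k)) := by
  refine ⟨∏ j ∈ Finset.univ.filter (fun j : Fin m => (j : ℕ) ≤ m / 2), (x k j.rev)⁻¹,
    Finset.prod_ne_zero_iff.2 fun j hj => inv_ne_zero (hx j (Finset.mem_filter.1 hj).2), ?_⟩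
  rw [annihilator, ← prod_filter_val_le (m := m) (by omega), map_prod, ← Finset.prod_mul_distrib,
    evalRecurrencePoly]
  refine Finset.prod_congr rfl fun j hj => ?_
  rw [revCoord_val, mul_sub, ← mul_assoc, ← C_mul,
    inv_mul_cancel₀ (hx j (Finset.mem_filter.1 hj).2), C_1, one_mul, mul_one]

theorem displacedMatrix_recurrence (hd : 2 ≤ d) (hm : Even m) (hm2 : 2 ≤ m)
    (x : Fin (d ^ m) → Fin m → F)
    (hx : ∀ (k : Fin (d ^ m)) (j : Fin m), (j : ℕ) ≤ m / 2 → x k j.rev ≠ 0) :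
    (displacedMatrix x).rank ≤ 2 ^ (m / 2) * d ^ (m / 2 - 1) ∧
    IsRecurrence (shiftMatrix F (d ^ m)) 1 (evalRecurrencePoly x) (displacedMatrix x)
      (evalMatrix x) ∧
    ∀ (k : Fin (d ^ m)) (j : ℕ),
      (evalRecurrencePoly x k j).natDegree ≤ (d ^ (1 + m / 2) - 1) / (d - 1) ∧
      (evalRecurrencePoly x k j).support.card ≤ 2 ^ (m / 2 + 1) := by
  choose a ha hg using fun k => evalRecurrencePoly_zero hm2 (hx k)
  refine ⟨?_, ?_, fun k j => ?_⟩
  · have h : displacedMatrix x = diagonal a * errorMatrix x := by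
      ext k c
      rw [displacedMatrix_row, hg, map_mul, ← mulVec_mulVec,
        aeval_annihilator_mulVec_evalMatrix (by omega)]
      simp [Algebra.algebraMap_eq_smul_one, smul_mulVec]
    rw [h]
    exact (rank_mul_le_right _ _).trans (rank_errorMatrix_le hd hm hm2 x)
  · rw [isRecurrence_one_iff fun i => rfl]
    refine ⟨fun k => isUnit_aeval_of_isNilpotent isNilpotent_shiftMatrix ?_,
      fun k => (displacedMatrix_row x k).symm⟩
    rw [hg, coeff_C_mul, coeff_zero_annihilator hd, mul_one]
    exact ha k
  · cases j with
    | zero =>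
      rw [hg, add_comm 1]
      refine ⟨(natDegree_C_mul_le _ _).trans (natDegree_annihilator_le hd _ _), ?_⟩
      refine le_trans (Finset.card_le_card ?_) (card_powSums_le d (m / 2 + 1))
      refine Finset.Subset.trans (fun e he => ?_) (support_annihilator_subset d _ (revCoord (x k)))
      rw [mem_support_iff, coeff_C_mul] at he
      exact mem_support_iff.2 (right_ne_zero_of_mul he)
    | succ j => simp [evalRecurrencePoly]

end Recurrence

/-! ### Straight-line computations -/

section Computes

variable {F : Type u} [Field F] {κ : Type}

/-- A computation tree with its registers renamed. -/
def CompTree.rename : {ι ι' : Type} → (ι → ι') → CompTree F κ ι → CompTree F κ ι'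
  | _, _, φ, .ret out => .ret (φ ∘ out)
  | _, _, φ, .const c next => .const c (next.rename (Option.map φ))
  | _, _, φ, .op o a b next => .op o (φ a) (φ b) (next.rename (Option.map φ))
  | _, _, φ, .test a p q => .test (φ a) (p.rename φ) (q.rename φ)

theorem CompTree.cost_rename {F : Type u} {ι ι' : Type} (φ : ι → ι') (Q : CompTree F κ ι) :
    (Q.rename φ).cost = Q.cost := by
  induction Q generalizing ι' with
  | ret out => rfl
  | const c next ih => simp [rename, cost, ih]
  | op o a b next ih => simp [rename, cost, ih]
  | test a p q ihp ihq => simp [rename, cost, ihp, ihq]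

theorem CompTree.run_rename {ι ι' : Type} (φ : ι → ι') (Q : CompTree F κ ι) (e : ι' → F) :
    (Q.rename φ).run e = Q.run (e ∘ φ) := by
  have key : ∀ {ι ι' : Type} (φ : ι → ι') (e : ι' → F) (v : F),
      ((fun o : Option ι' => o.elim v e) ∘ Option.map φ) = fun o => o.elim v (e ∘ φ) := by
    intro ι ι' φ e v
    ext o
    cases o <;> rfl
  induction Q generalizing ι' with
  | ret out => rfl
  | const c next ih => simp only [rename, run, ih, key]
  | op o a b next ih => simp only [rename, run, ih, key, Function.comp_apply]
  | test a p q ihp ihq => simp only [rename, run, ihp, ihq, Function.comp_apply]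

variable {X : Type*} {S : Set (X → F)}

/-- The registers `e`, as functions of a parameter in `X`, include all functions in `S`. -/
def Holds (S : Set (X → F)) {ι : Type} (e : X → ι → F) : Prop :=
  ∀ s ∈ S, ∃ i, ∀ x, e x i = s x

/-- Whenever the registers hold the functions in `S`, the function `v` can be put into a new
register with at most `n` operations. -/
def Computes (S : Set (X → F)) (n : ℕ) (v : X → F) : Prop :=
  ∀ (ι : Type) (e : X → ι → F), Holds S e → ∀ (κ : Type) (Q : CompTree F κ (Option ι)),
    ∃ P : CompTree F κ ι, P.cost ≤ n + Q.cost ∧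
      ∀ x, P.run (e x) = Q.run fun o => o.elim (v x) (e x)

theorem Computes.mono {n n' : ℕ} {v : X → F} (h : Computes S n v) (hn : n ≤ n') :
    Computes S n' v := fun ι e he κ Q => by
  obtain ⟨P, hP, hr⟩ := h ι e he κ Q
  exact ⟨P, by omega, hr⟩

theorem Computes.of_subset {S' : Set (X → F)} {n : ℕ} {v : X → F} (h : Computes S n v)
    (hS : S ⊆ S') : Computes S' n v :=
  fun ι e he => h ι e fun s hs => he s (hS hs)

/-- A value already held costs nothing: the continuation is redirected to its register. -/
theorem Computes.of_mem {v : X → F} (h : v ∈ S) : Computes S 0 v := fun ι e he κ Q => by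
  obtain ⟨i, hi⟩ := he v h
  refine ⟨Q.rename fun o => o.elim i id, by rw [CompTree.cost_rename]; omega, fun x => ?_⟩
  rw [CompTree.run_rename]
  congr 1
  ext o
  cases o with
  | none => exact hi x
  | some j => rfl

theorem Computes.const (c : F) : Computes S 1 fun _ => c := fun ι e he κ Q =>
  ⟨.const c Q, by rw [CompTree.cost]; omega, fun x => rfl⟩

theorem Holds.extend {F : Type u} {X : Type*} {S : Set (X → F)} {ι : Type} {e : X → ι → F} (he : Holds S e) (v : X → F) :
    Holds (insert v S) fun x (o : Option ι) => o.elim (v x) (e x) := by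
  rintro s (rfl | hs)
  · exact ⟨none, fun x => rfl⟩
  · obtain ⟨i, hi⟩ := he s hs
    exact ⟨some i, hi⟩

theorem Computes.bind {n n' : ℕ} {a b : X → F} (ha : Computes S n a)
    (hb : Computes (insert a S) n' b) : Computes S (n + n') b := fun ι e he κ Q => by
  -- The renaming makes `Q` skip the register that holds the intermediate value `a`.
  obtain ⟨P, hP, hr⟩ := hb _ _ (he.extend a) κ (Q.rename (Option.map some))
  obtain ⟨P', hP', hr'⟩ := ha ι e he κ P
  rw [CompTree.cost_rename] at hP
  refine ⟨P', by omega, fun x => ?_⟩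
  rw [hr', hr, CompTree.run_rename]
  congr 1
  ext o
  cases o <;> rfl

theorem Computes.op_of_mem (o : ArithOp) {a b v : X → F} (ha : a ∈ S) (hb : b ∈ S)
    (h : ∀ x, o.apply (a x) (b x) = some (v x)) : Computes S 1 v := fun ι e he κ Q => by
  obtain ⟨i, hi⟩ := he a ha
  obtain ⟨j, hj⟩ := he b hb
  refine ⟨.op o i j Q, by rw [CompTree.cost]; omega, fun x => ?_⟩
  simp only [CompTree.run, hi, hj, h, Option.bind_some]

theorem Computes.op (o : ArithOp) {n n' : ℕ} {a b v : X → F} (ha : Computes S n a)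
    (hb : Computes S n' b) (h : ∀ x, o.apply (a x) (b x) = some (v x)) :
    Computes S (n + n' + 1) v := by
  rw [add_assoc]
  refine ha.bind ((hb.of_subset (Set.subset_insert _ _)).bind ?_)
  exact .op_of_mem o (Set.mem_insert_of_mem _ (Set.mem_insert _ _)) (Set.mem_insert _ _) h

theorem Computes.sub {n n' : ℕ} {a b : X → F} (ha : Computes S n a) (hb : Computes S n' b) :
    Computes S (n + n' + 1) fun x => a x - b x := ha.op .sub hb fun _ => rfl

theorem Computes.mul {n n' : ℕ} {a b : X → F} (ha : Computes S n a) (hb : Computes S n' b) :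
    Computes S (n + n' + 1) fun x => a x * b x := ha.op .mul hb fun _ => rfl

theorem Computes.neg {n : ℕ} {a : X → F} (ha : Computes S n a) :
    Computes S (n + 2) fun x => -a x :=
  -- Two extra operations: loading `0` and subtracting.
  by simpa using ((Computes.const 0).sub ha).mono (n' := n + 2) (by omega)


theorem Computes.prod {α : Type*} (s : Finset α) {n : ℕ} {a : α → X → F}
    (ha : ∀ i ∈ s, Computes S n (a i)) :
    Computes S (s.card * (n + 1) + 1) fun x => ∏ i ∈ s, a i x := by
  classical
  induction s using Finset.induction_on with
  | empty => simpa using Computes.const 1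
  | insert i s hi ih =>
    simp only [Finset.prod_insert hi, Finset.card_insert_of_notMem hi]
    refine ((ha i (Finset.mem_insert_self _ _)).mul
      (ih fun j hj => ha j (Finset.mem_insert_of_mem hj))).mono ?_
    rw [add_mul]
    omega

/-- Repeated squaring: each halving of the exponent costs at most two multiplications. -/
theorem Computes.pow_of_mem {a : X → F} (ha : a ∈ S) (k : ℕ) :
    Computes S (2 * Nat.log 2 k + 1) fun x => a x ^ k := by
  induction k using Nat.strong_induction_on with
  | _ k ih =>
    rcases Nat.lt_or_ge k 2 with hk | hk
    · interval_cases k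
      · simpa using Computes.const 1
      · simpa using (Computes.of_mem ha).mono (by omega)
    · have h1 := ih (k / 2) (by omega)
      have h2 : Nat.log 2 k = Nat.log 2 (k / 2) + 1 := Nat.log_of_one_lt_of_le (by norm_num) hk
      have hb : Computes (insert (fun x => a x ^ (k / 2)) S) 2 fun x => a x ^ k := by
        have hm := Set.mem_insert (fun x => a x ^ (k / 2)) S
        have hsq := (Computes.of_mem hm).mul (Computes.of_mem hm)
        rcases Nat.mod_two_eq_zero_or_one k with h | h
        · convert hsq.mono (n' := 2) (by omega) using 2
          rw [← pow_add]
          congr 1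
          omega
        · convert hsq.mul (Computes.of_mem (Set.mem_insert_of_mem _ ha)) using 2
          rw [← pow_add, ← pow_succ]
          congr 1
          omega
      exact (h1.bind hb).mono (by omega)

theorem Computes.pow {a : X → F} (ha : a ∈ S) {k d : ℕ} (hk : k ≤ d) :
    Computes S (2 * Nat.log 2 d + 1) fun x => a x ^ k :=
  (Computes.pow_of_mem ha k).mono (by have := Nat.log_mono_right (b := 2) hk; omega)

/-- Running a tree on inputs that are themselves computed. -/
theorem Computes.exists_run {σ : Type} [Fintype σ] {n : ℕ} {w : X → σ → F}
    (hw : ∀ t, Computes S n fun x => w x t) (Q : CompTree F κ σ) {ι : Type} {e : X → ι → F}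
    (he : Holds S e) :
    ∃ P : CompTree F κ ι, P.cost ≤ n * Fintype.card σ + Q.cost ∧
      ∀ x, P.run (e x) = Q.run (w x) := by
  classical
  -- Here `s` is the set of inputs of `Q` that are not yet in registers.
  have key : ∀ (s : Finset σ) (ι : Type) (e : X → ι → F), Holds S e →
      (∀ t ∉ s, ∃ i, ∀ x, e x i = w x t) →
      ∃ P : CompTree F κ ι, P.cost ≤ n * s.card + Q.cost ∧ ∀ x, P.run (e x) = Q.run (w x) := by
    intro s
    induction s using Finset.induction_on with
    | empty =>
      intro ι e _ h
      choose φ hφ using fun t => h t (Finset.notMem_empty t)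
      refine ⟨Q.rename φ, by rw [CompTree.cost_rename]; omega, fun x => ?_⟩
      rw [CompTree.run_rename]
      congr 1
      ext t
      exact hφ t x
    | insert a s ha ih =>
      intro ι e he h
      have he' := he.extend fun x => w x a
      obtain ⟨P, hP, hr⟩ := ih (Option ι) _ (fun s hs => he' s (Set.mem_insert_of_mem _ hs))
        fun t ht => by
          by_cases hta : t = a
          · exact ⟨none, fun x => by rw [hta]; rfl⟩
          · obtain ⟨i, hi⟩ := h t (by simp [hta, ht])
            exact ⟨some i, hi⟩
      obtain ⟨P', hP', hr'⟩ := hw a ι e he κ P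
      refine ⟨P', ?_, fun x => by rw [hr', hr]⟩
      rw [Finset.card_insert_of_notMem ha, mul_add]
      omega
  exact key Finset.univ ι e he fun t ht => absurd (Finset.mem_univ t) ht

end Computes

/-! ### Multipoint evaluation by matrix-vector multiplication -/

section Evaluation

variable {F : Type u} [Field F] {m d : ℕ}

/-- The polynomial and the points of an instance of multipoint evaluation. -/
abbrev EvalInstance (F : Type u) [Field F] (m d : ℕ) : Type u :=
  MvPolynomial (Fin m) F × (Fin (d ^ m) → Fin m → F)

/-- The inputs of multipoint evaluation, as functions of the instance. -/
def evalInputs (F : Type u) [Field F] (m d : ℕ) : Set (EvalInstance F m d → F) :=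
  Set.range fun (i : EvalInput m d) z => EvalInput.value z.1 z.2 i

theorem holds_evalInputs : Holds (evalInputs F m d) fun z => EvalInput.value z.1 z.2 := by
  rintro _ ⟨i, rfl⟩
  exact ⟨i, fun _ => rfl⟩

theorem revCoord_mem_evalInputs (k : Fin (d ^ m)) {j : ℕ} (hj : j < m) :
    (fun z : EvalInstance F m d => revCoord (z.2 k) j) ∈ evalInputs F m d :=
  ⟨.coord k (Fin.rev ⟨j, hj⟩), by ext z; simp [revCoord, hj, EvalInput.value]⟩

theorem computes_coeff_annihilator {X : Type*} {S : Set (X → F)} (hd : 2 ≤ d) {n c : ℕ}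
    {y : X → ℕ → F} (hy : ∀ j < n, Computes S c fun x => y x j) (e : ℕ) :
    Computes S (n * (c + 3) + 1) fun x => (annihilator d n (y x)).coeff e := by
  by_cases he : e ∈ powSums d n
  · obtain ⟨J, hJ, rfl⟩ := Finset.mem_image.1 he
    have hJ := Finset.mem_powerset.1 hJ
    simp only [coeff_annihilator_sum hd _ hJ]
    refine (Computes.prod J fun j hj => (hy j (Finset.mem_range.1 (hJ hj))).neg).mono ?_
    have := Finset.card_le_card hJ
    rw [Finset.card_range] at this
    gcongr
  · have h : ∀ x, (annihilator d n (y x)).coeff e = 0 := fun x =>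
      notMem_support_iff.1 fun h => he (support_annihilator_subset d n _ h)
    simp only [h]
    exact (Computes.const 0).mono (by omega)

theorem computes_coeff_digitPoly {X : Type*} {S : Set (X → F)} (hd : 2 ≤ d) {n c : ℕ}
    {y : X → ℕ → F} (hy : ∀ j < n, (fun x => y x j) ∈ S) (hc : c < d ^ n) :
    Computes S (n * (2 * Nat.log 2 d + 2) + 1) fun x => (digitPoly d n (y x)).coeff c := by
  simp only [coeff_digitPoly (by omega : 0 < d) n _ hc]
  have h := Computes.prod (S := S) (Finset.range n) (n := 2 * Nat.log 2 d + 1)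
    (a := fun j x => y x j ^ (c / d ^ j % d)) fun j hj =>
      Computes.pow (hy j (Finset.mem_range.1 hj)) (Nat.mod_lt _ (by omega)).le
  rwa [Finset.card_range] at h

theorem computes_coeff_sub_mul {X : Type*} {S : Set (X → F)} {n n' c : ℕ} {a : X → F}
    {P : X → F[X]} (ha : Computes S n a) (hP : ∀ c' ≤ c, Computes S n' fun x => (P x).coeff c') :
    Computes S (n + 2 * n' + 2) fun x => ((1 - C (a x) * Polynomial.X) * P x).coeff c := by
  cases c with
  | zero => simpa [sub_mul, mul_assoc] using (hP 0 le_rfl).mono (by omega)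
  | succ c =>
    simp only [sub_mul, one_mul, mul_assoc, coeff_sub, coeff_C_mul, coeff_X_mul]
    exact ((hP (c + 1) le_rfl).sub (ha.mul (hP c (by omega)))).mono (by omega)

/-- The row `k` and column `c` are discrete parameters. The divisibility condition is thus settled
when the tree is built, and the tree needs no test. -/
theorem computes_errorMatrix (hd : 2 ≤ d) (hm : Even m) (hm2 : 2 ≤ m) (k c : Fin (d ^ m)) :
    Computes (evalInputs F m d) (12 * (m * Nat.log 2 d)) fun z => errorMatrix z.2 k c := by
  simp only [errorMatrix_apply hd hm hm2]
  obtain ⟨h, rfl⟩ : ∃ h, m = 2 * (h + 1) := by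
    obtain ⟨n, rfl⟩ := hm
    exact ⟨n - 1, by omega⟩
  have hq := div_pow_half_lt hm hm2 c.isLt
  have hh : 2 * (h + 1) / 2 = h + 1 := by omega
  rw [hh, Nat.add_sub_cancel] at hq ⊢
  have hl : 1 ≤ Nat.log 2 d := Nat.log_pos (by norm_num) hd
  have hpow : ∀ j < 2 * (h + 1), Computes (evalInputs F (2 * (h + 1)) d) (2 * Nat.log 2 d + 1)
      fun z => revCoord (z.2 k) j ^ d :=
    fun j hj => Computes.pow (revCoord_mem_evalInputs k hj) le_rfl
  have h1 : ∀ e, Computes (evalInputs F (2 * (h + 1)) d) ((h + 1) * (2 * Nat.log 2 d + 4) + 1)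
      fun z => (annihilator d (h + 1) fun j => revCoord (z.2 k) j ^ d).coeff e :=
    computes_coeff_annihilator hd fun j hj => hpow j (by omega)
  have hdig : ∀ c' ≤ (c : ℕ) / d ^ (h + 1 + 1), Computes (evalInputs F (2 * (h + 1)) d)
      (h * (2 * Nat.log 2 d + 2) + 1)
      fun z => (digitPoly d h fun j => revCoord (z.2 k) (h + 1 + 1 + j)).coeff c' :=
    fun c' hc' => computes_coeff_digitPoly hd
      (fun j hj => revCoord_mem_evalInputs k (by omega)) (hc'.trans_lt hq)
  have h2 := computes_coeff_sub_mul (hpow (h + 1) (by omega)) hdig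
  have harith : (h + 1) * (2 * Nat.log 2 d + 4) + 1 +
      (2 * Nat.log 2 d + 1 + 2 * (h * (2 * Nat.log 2 d + 2) + 1) + 2) + 1 ≤
      12 * (2 * (h + 1) * Nat.log 2 d) := by
    nlinarith
  split_ifs
  · exact ((h1 _).mul h2).mono harith
  · simp only [zero_mul]
    refine (Computes.const 0).mono ?_
    nlinarith

/-- Columns correspond to exponent tuples through base-`d` digits. `finFunctionFinEquiv` lists the
least significant digit first, whence the reversal. -/
theorem evalMatrix_mulVec (hd : 2 ≤ d) {f : MvPolynomial (Fin m) F} (hf : ∀ l, f.degreeOf l < d)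
    (x : Fin (d ^ m) → Fin m → F) (b : Fin (d ^ m) → F)
    (hb : ∀ c, b c = f.coeff (Finsupp.equivFunOnFinite.symm fun l =>
      ((finFunctionFinEquiv.symm c (Fin.rev l) : Fin d) : ℕ))) (k : Fin (d ^ m)) :
    (evalMatrix x *ᵥ b) k = MvPolynomial.eval (x k) f := by
  let φ : (Fin m → Fin d) ↪ (Fin m →₀ ℕ) :=
    ⟨fun e => Finsupp.equivFunOnFinite.symm fun l => (e l : ℕ), fun e e' h => by
      ext l
      exact DFunLike.congr_fun h l⟩
  have hsub : f.support ⊆ Finset.univ.map φ := by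
    intro s hs
    refine Finset.mem_map.2 ⟨fun l => ⟨s l, ?_⟩, Finset.mem_univ _, by ext l; rfl⟩
    exact (MvPolynomial.degreeOf_lt_iff (by omega)).1 (hf l) s hs
  rw [MvPolynomial.eval_eq', Finset.sum_subset hsub fun s _ hs => by
    rw [MvPolynomial.notMem_support_iff.1 hs, zero_mul], Finset.sum_map, mulVec, dotProduct]
  have hcol : ∀ (c : Fin (d ^ m)) (l : Fin m),
      ((finFunctionFinEquiv.symm c (Fin.rev l) : Fin d) : ℕ) =
        (c : ℕ) / d ^ (m - 1 - (l : ℕ)) % d := by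
    intro c l
    rw [finFunctionFinEquiv_symm_apply_val, Fin.val_rev, Nat.sub_sub, add_comm 1]
  refine Fintype.sum_equiv (finFunctionFinEquiv.symm.trans
    (Equiv.arrowCongr Fin.revPerm (Equiv.refl (Fin d)))) _ _ fun c => ?_
  rw [mul_comm, hb]
  simp only [evalMatrix, of_apply, ← hcol]
  rfl

/-- The inputs of the multiplication problem as a sum type. -/
def MulInput.equiv (N t r : ℕ) (supp : Fin N → Fin (t + 1) → Finset ℕ) :
    MulInput N t r supp ≃
      (Σ i : Fin N, Σ j : Fin (t + 1), supp i j) ⊕ (Fin N × Fin r) ⊕ (Fin r × Fin N) ⊕ Fin N where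
  toFun
    | .coeff i j e he => .inl ⟨i, j, e, he⟩
    | .left i k => .inr (.inl (i, k))
    | .right k i => .inr (.inr (.inl (k, i)))
    | .vec i => .inr (.inr (.inr i))
  invFun
    | .inl ⟨i, j, e, he⟩ => .coeff i j e he
    | .inr (.inl (i, k)) => .left i k
    | .inr (.inr (.inl (k, i))) => .right k i
    | .inr (.inr (.inr i)) => .vec i
  left_inv a := by cases a <;> rfl
  right_inv a := by rcases a with ⟨i, j, e, he⟩ | ⟨i, k⟩ | ⟨k, i⟩ | i <;> rfl

noncomputable instance (N t r : ℕ) (supp : Fin N → Fin (t + 1) → Finset ℕ) :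
    Fintype (MulInput N t r supp) :=
  Fintype.ofEquiv _ (MulInput.equiv N t r supp).symm

theorem MulInput.card_le {N t r D : ℕ} {supp : Fin N → Fin (t + 1) → Finset ℕ}
    (h : ∀ i j, (supp i j).card ≤ D) :
    Fintype.card (MulInput N t r supp) ≤ N * ((t + 1) * D) + 2 * (r * N) + N := by
  rw [Fintype.card_congr (MulInput.equiv N t r supp)]
  simp only [Fintype.card_sum, Fintype.card_sigma, Fintype.card_prod, Fintype.card_fin,
    Fintype.card_coe]
  have h1 : ∑ i : Fin N, ∑ j : Fin (t + 1), (supp i j).card ≤ N * ((t + 1) * D) := by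
    calc _ ≤ ∑ i : Fin N, ∑ j : Fin (t + 1), D :=
          Finset.sum_le_sum fun i _ => Finset.sum_le_sum fun j _ => h i j
      _ = _ := by simp
  nlinarith

/-- The bound is the cost per input times the number of inputs, plus the cost of the multiplication
itself. -/
theorem exists_evaluation_tree (hd : 2 ≤ d) (hm : Even m) (hm2 : 2 ≤ m) {D : ℕ}
    {supp : Fin (d ^ m) → Fin 2 → Finset ℕ} (hD : ∀ i j, (supp i j).card ≤ D)
    (hsupp : ∀ (x : Fin (d ^ m) → Fin m → F) i (j : Fin 2),
      (annihilatorPoly x i j).support ⊆ supp i j)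
    {Q : CompTree F (Fin (d ^ m)) (MulInput (d ^ m) 1 (2 ^ (m / 2) * d ^ (m / 2 - 1)) supp)}
    (hQ : Multiplies Q) :
    MultipointEvaluationWithin F m d ((12 * (m * Nat.log 2 d) *
      (d ^ m * (2 * D) + 2 * (2 ^ (m / 2) * d ^ (m / 2 - 1) * d ^ m) + d ^ m) + Q.cost : ℕ) : ℝ) := by
  obtain ⟨σ, hσ⟩ := exists_errorMatrix_eq F hd hm hm2
  have hl : 1 ≤ Nat.log 2 d := Nat.log_pos (by norm_num) hd
  have hml : 2 ≤ m * Nat.log 2 d := by nlinarith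
  let vec : EvalInstance F m d → Fin (d ^ m) → F := fun z c =>
    z.1.coeff (Finsupp.equivFunOnFinite.symm fun l =>
      ((finFunctionFinEquiv.symm c (Fin.rev l) : Fin d) : ℕ))
  have hw : ∀ t, Computes (evalInputs F m d) (12 * (m * Nat.log 2 d)) fun z : EvalInstance F m d =>
      MulInput.value (supp := supp) (annihilatorPoly z.2) ((errorMatrix z.2).submatrix id σ)
        (selector F σ) (vec z) t := by
    rintro (⟨i, j, e, he⟩ | ⟨i, k⟩ | ⟨k, i⟩ | i)
    · simp only [MulInput.value, annihilatorPoly]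
      by_cases hj : (j : ℕ) = 0
      · simp only [if_pos hj]
        refine (computes_coeff_annihilator hd (c := 0) (n := m / 2 + 1)
          (fun j hj => Computes.of_mem (revCoord_mem_evalInputs i (by omega))) e).mono ?_
        have : m ≤ m * Nat.log 2 d := Nat.le_mul_of_pos_right _ hl
        omega
      · simp only [if_neg hj, coeff_zero]
        exact (Computes.const 0).mono (by omega)
    · exact computes_errorMatrix hd hm hm2 i (σ k)
    · exact (Computes.const _).mono (by omega)
    · refine (Computes.of_mem ?_).mono (Nat.zero_le _)
      exact Set.mem_range.2 ⟨.coeff fun l => finFunctionFinEquiv.symm i (Fin.rev l), rfl⟩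
  obtain ⟨P, hP, hr⟩ := Computes.exists_run hw Q holds_evalInputs
  refine ⟨P, fun f x hf => ?_, ?_⟩
  · rw [hr (f, x), hQ _ _ _ (evalMatrix x) _ (hsupp x)
      (by rw [hσ]; exact isRecurrence_errorMatrix hd x)]
    congr 1
    ext k
    exact evalMatrix_mulVec hd hf x _ (fun c => rfl) k
  · refine Nat.cast_le.2 (hP.trans ?_)
    gcongr
    exact MulInput.card_le hD

end Evaluation

/-! ### Asymptotic bounds -/

section Asymptotics

variable {F : Type u} [Field F]

theorem MultipointEvaluationWithin.mono {m d : ℕ} {T T' : ℝ}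
    (h : MultipointEvaluationWithin F m d T) (hT : T ≤ T') : MultipointEvaluationWithin F m d T' :=
  let ⟨P, hP, hc⟩ := h
  ⟨P, hP, hc.trans hT⟩

/-- From `m log d ≤ log T`; the factor `2` covers `1 / log 2`. -/
theorem mul_log_two_le {m d : ℕ} (hd : 2 ≤ d) {T : ℝ} (hT : (d : ℝ) ^ m ≤ T) :
    (m : ℝ) * Nat.log 2 d ≤ 2 * Real.log (T + 2) := by
  have hd0 : (0 : ℝ) < d := by positivity
  have h1 : (Nat.log 2 d : ℝ) * Real.log 2 ≤ Real.log d := by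
    rw [← Real.log_pow]
    refine Real.log_le_log (by positivity) ?_
    exact_mod_cast Nat.pow_log_le_self 2 (by omega)
  have h2 : (m : ℝ) * Real.log d ≤ Real.log (T + 2) := by
    rw [← Real.log_pow]
    exact Real.log_le_log (by positivity) (by linarith)
  have h3 : (m : ℝ) * (Nat.log 2 d * Real.log 2) ≤ m * Real.log d := by gcongr
  have h4 : (m : ℝ) * Nat.log 2 d * (1 / 2) ≤ m * Nat.log 2 d * Real.log 2 := by
    gcongr
    linarith [Real.log_two_gt_d9]
  linarith

/-- Here `n` counts the inputs to prepare, and `q` is the cost of a multiplication of size `T₁`. As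
`T₁ + 2 ≤ A (T + 2)` and `L ≥ 1`, the logarithm grows by a constant factor only. -/
theorem exists_softO_bound (K : ℝ) (c : ℕ) {A : ℝ} (hA : 1 ≤ A) :
    ∃ (K' : ℝ) (c' : ℕ), ∀ (m d : ℕ) (T T₁ n q : ℝ), 2 ≤ m → 2 ≤ d → (d : ℝ) ^ m ≤ T →
      0 ≤ T₁ → T₁ ≤ A * T → 0 ≤ n → n ≤ A * T → q ≤ softO K c T₁ →
      12 * (m * Nat.log 2 d) * n + q ≤ softO K' c' T := by
  refine ⟨24 * A + |K| * A * (Real.log A + 1) ^ c, c + 1,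
    fun m d T T₁ n q hm hd hT hT0 hT₁ hn0 hn hq => ?_⟩
  have hT1 : 1 ≤ T := le_trans (one_le_pow₀ (by exact_mod_cast (by omega : 1 ≤ d))) hT
  have hL : 1 ≤ Real.log (T + 2) := by
    rw [Real.le_log_iff_exp_le (by linarith)]
    linarith [Real.exp_one_lt_d9]
  set L := Real.log (T + 2) with hLdef
  have hlogA : 0 ≤ Real.log A := Real.log_nonneg hA
  have hlog : Real.log (T₁ + 2) ≤ (Real.log A + 1) * L := by
    have h : Real.log (T₁ + 2) ≤ Real.log A + L := by
      rw [hLdef, ← Real.log_mul (by linarith) (by linarith)]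
      exact Real.log_le_log (by linarith) (by nlinarith)
    nlinarith
  have hlog0 : 0 ≤ Real.log (T₁ + 2) := Real.log_nonneg (by linarith)
  have h1 : 12 * (m * Nat.log 2 d) * n ≤ 12 * (2 * L) * (A * T) := by
    have := mul_log_two_le (m := m) hd hT
    gcongr
  have h2 : softO K c T₁ ≤ |K| * (A * T) * ((Real.log A + 1) * L) ^ c := by
    rw [softO]
    have := le_abs_self K
    gcongr
  have h3 : L ≤ L ^ (c + 1) := le_self_pow₀ hL (by omega)
  have h4 : L ^ c ≤ L ^ (c + 1) := pow_le_pow_right₀ hL (by omega)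
  have hAT : 0 ≤ A * T := by positivity
  calc 12 * (m * Nat.log 2 d) * n + q
      ≤ 12 * (2 * L) * (A * T) + |K| * (A * T) * ((Real.log A + 1) * L) ^ c := by linarith
    _ = 24 * (A * T) * L + |K| * (A * T) * (Real.log A + 1) ^ c * L ^ c := by
        rw [mul_pow]; ring
    _ ≤ 24 * (A * T) * L ^ (c + 1) +
          |K| * (A * T) * (Real.log A + 1) ^ c * L ^ (c + 1) := by gcongr
    _ = softO (24 * A + |K| * A * (Real.log A + 1) ^ c) (c + 1) T := by
        rw [softO]; ring

theorem exists_rpow_bound {m : ℕ} {K a b C : ℝ} {c : ℕ} {T : ℕ → ℝ} (ha : 0 < a) (hab : a < b)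
    (hT1 : ∀ d, 2 ≤ d → 1 ≤ T d) (hT : ∀ d : ℕ, 2 ≤ d → T d ≤ C * (d : ℝ) ^ a)
    (h : ∀ d, 2 ≤ d → MultipointEvaluationWithin F m d (softO K c (T d))) :
    ∃ (ε K' : ℝ), 0 < ε ∧ ∀ d : ℕ, 2 ≤ d →
      MultipointEvaluationWithin F m d (K' * (d : ℝ) ^ (b - ε)) := by
  have hC : 0 < C := by
    have h2 := (hT1 2 le_rfl).trans (hT 2 le_rfl)
    by_contra! hC
    have : C * ((2 : ℕ) : ℝ) ^ a ≤ 0 := mul_nonpos_of_nonpos_of_nonneg hC (by positivity)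
    linarith
  -- By `log z ≤ z^η / η`, the `c` logarithms cost at most half of the gap `b - a`; the other half
  -- is `ε`.
  obtain ⟨η, hη, hηc⟩ : ∃ η : ℝ, 0 < η ∧ a * η * c ≤ (b - a) / 2 := by
    have hba : 0 < b - a := sub_pos.2 hab
    refine ⟨(b - a) / (2 * a * (c + 1)), by positivity, ?_⟩
    have : a * ((b - a) / (2 * a * (c + 1))) * c = (b - a) / 2 * (c / (c + 1)) := by
      field_simp
    rw [this]
    refine mul_le_of_le_one_right (by linarith) ((div_le_one (by positivity)).2 (by linarith))
  refine ⟨(b - a) / 2, |K| * C * ((3 * C) ^ η / η) ^ c, by linarith, fun d hd =>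
    (h d hd).mono ?_⟩
  have hd1 : (1 : ℝ) ≤ d := by exact_mod_cast (by omega : 1 ≤ d)
  have hd0 : (0 : ℝ) < d := by linarith
  have hTd := hT1 d hd
  have hlog : Real.log (T d + 2) ≤ (3 * C) ^ η / η * (d : ℝ) ^ (a * η) := by
    calc Real.log (T d + 2) ≤ (T d + 2) ^ η / η := Real.log_le_rpow_div (by linarith) hη
      -- Since `T d ≥ 1`, `T d + 2 ≤ 3 T d`.
      _ ≤ (3 * C * (d : ℝ) ^ a) ^ η / η := by
          have := hT d hd
          gcongr
          linarith
      _ = (3 * C) ^ η / η * (d : ℝ) ^ (a * η) := by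
          rw [Real.mul_rpow (by positivity) (by positivity), ← Real.rpow_mul hd0.le]
          ring
  have hlog0 : 0 ≤ Real.log (T d + 2) := Real.log_nonneg (by linarith)
  calc softO K c (T d)
      ≤ |K| * (C * (d : ℝ) ^ a) * ((3 * C) ^ η / η * (d : ℝ) ^ (a * η)) ^ c := by
        rw [softO]
        have := hT d hd
        have := le_abs_self K
        gcongr
    _ = |K| * C * ((3 * C) ^ η / η) ^ c * ((d : ℝ) ^ a * (d : ℝ) ^ (a * η * c)) := by
        rw [mul_pow, Real.rpow_mul_natCast hd0.le (a * η)]; ring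
    _ ≤ |K| * C * ((3 * C) ^ η / η) ^ c * (d : ℝ) ^ (b - (b - a) / 2) := by
        rw [← Real.rpow_add hd0]
        have hexp : a + a * η * c ≤ b - (b - a) / 2 := by linarith
        gcongr

end Asymptotics

/-! ### Consequences of fast multiplication -/

section Consequences

variable {F : Type u} [Field F]

theorem support_annihilatorPoly_subset {m d : ℕ} (x : Fin (d ^ m) → Fin m → F) (i : Fin (d ^ m))
    (j : ℕ) : (annihilatorPoly x i j).support ⊆ powSums d (m / 2 + 1) := by
  rw [annihilatorPoly]
  split_ifs
  · exact support_annihilator_subset _ _ _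
  · simp

theorem one_le_geomQuotient {m d : ℕ} (hd : 2 ≤ d) : 1 ≤ (d ^ (1 + m / 2) - 1) / (d - 1) := by
  rw [← Nat.geomSum_eq hd, add_comm 1, Finset.sum_range_succ', pow_zero]
  omega

theorem geomQuotient_le {m d : ℕ} (hd : 2 ≤ d) : (d ^ (1 + m / 2) - 1) / (d - 1) ≤ 2 * d ^ (m / 2) := by
  rw [← Nat.geomSum_eq hd, add_comm 1, Finset.sum_range_succ]
  have := Nat.geomSum_lt (m := d) (n := m / 2) (s := Finset.range (m / 2)) hd
    fun k hk => Finset.mem_range.1 hk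
  omega

theorem rank_mul_eq {m : ℕ} (d : ℕ) (hm : Even m) (hm2 : 2 ≤ m) :
    2 ^ (m / 2) * d ^ (m / 2 - 1) * d ^ m = 2 ^ (m / 2) * d ^ (3 * m / 2 - 1) := by
  obtain ⟨h, rfl⟩ := hm
  rw [mul_assoc, ← pow_add]
  congr 2
  omega

theorem sparse_bounds {m d : ℕ} (hm : Even m) (hm2 : 2 ≤ m) (hd : 2 ≤ d) :
    2 ^ (m / 2 + 1) * d ^ m ≤ 4 * (2 * d) ^ (3 * m / 2 - 1) ∧
    2 ^ (m / 2) * d ^ (m / 2 - 1) * d ^ m ≤ (2 * d) ^ (3 * m / 2 - 1) := by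
  rw [rank_mul_eq d hm hm2, mul_pow]
  obtain ⟨h, rfl⟩ := hm
  constructor
  · rw [← mul_assoc, show 4 = 2 ^ 2 by norm_num, ← pow_add]
    exact Nat.mul_le_mul (Nat.pow_le_pow_right (by norm_num) (by omega))
      (Nat.pow_le_pow_right (by omega) (by omega))
  · exact Nat.mul_le_mul_right _ (Nat.pow_le_pow_right (by norm_num) (by omega))

theorem evaluation_of_fastSparse (hF : FastSparseMultiplication F) :
    ∃ (K : ℝ) (c : ℕ), ∀ (m d : ℕ), Even m → 2 ≤ m → 2 ≤ d →
      MultipointEvaluationWithin F m d (softO K c ((2 * d : ℝ) ^ (3 * m / 2 - 1))) := by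
  obtain ⟨p, K, c, H⟩ := hF
  -- With `DN ≤ 4T` and `rN ≤ T`, the problem size is at most `(4 p(1) + 1) T`, and the number of
  -- inputs `2DN + 2rN + N` is below `20 T`.
  obtain ⟨K', c', hK⟩ := exists_softO_bound K c (A := ((4 * p.eval 1 + 20 : ℕ) : ℝ))
    (by exact_mod_cast (by omega : 1 ≤ 4 * p.eval 1 + 20))
  refine ⟨K', c', fun m d hm hm2 hd => ?_⟩
  obtain ⟨Q, hQ, hQc⟩ := H (d ^ m) 1 (2 ^ (m / 2) * d ^ (m / 2 - 1)) (2 ^ (m / 2 + 1))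
    (fun _ _ => powSums d (m / 2 + 1)) le_rfl Nat.one_le_two_pow fun _ _ => card_powSums_le _ _
  have hE := exists_evaluation_tree hd hm hm2 (fun _ _ => card_powSums_le d (m / 2 + 1))
    (fun x i j => support_annihilatorPoly_subset x i j) hQ
  refine hE.mono ?_
  rw [Nat.cast_add, Nat.cast_mul, Nat.cast_mul, Nat.cast_mul, Nat.cast_ofNat]
  obtain ⟨h1, h2⟩ := sparse_bounds hm hm2 hd
  have h3 : d ^ m ≤ 2 ^ (m / 2 + 1) * d ^ m := Nat.le_mul_of_pos_left _ (by positivity)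
  have hN : d ^ m ≤ (2 * d) ^ (3 * m / 2 - 1) := by
    calc d ^ m ≤ d ^ (3 * m / 2 - 1) := Nat.pow_le_pow_right (by omega) (by
          obtain ⟨h, rfl⟩ := hm; omega)
      _ ≤ _ := Nat.pow_le_pow_left (by omega) _
  have hcast : (2 * d : ℝ) ^ (3 * m / 2 - 1) = (((2 * d) ^ (3 * m / 2 - 1) : ℕ) : ℝ) := by
    push_cast; rfl
  rw [hcast]
  refine hK m d _ _ _ _ hm2 hd (by exact_mod_cast hN) (Nat.cast_nonneg _) ?_ (Nat.cast_nonneg _)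
    ?_ hQc
  · rw [← Nat.cast_mul, Nat.cast_le, mul_assoc (p.eval 1)]
    generalize (2 * d) ^ (3 * m / 2 - 1) = T at *
    have h4 := Nat.mul_le_mul_left (p.eval 1) h1
    rw [add_mul, mul_comm 4, mul_assoc (p.eval 1) 4]
    omega
  · rw [← Nat.cast_mul, Nat.cast_le, add_mul,
      show d ^ m * (2 * 2 ^ (m / 2 + 1)) = 2 * (2 ^ (m / 2 + 1) * d ^ m) by ring]
    omega

theorem evaluation_of_fastDegree (hF : FastDegreeMultiplication F) :
    ∃ (K : ℝ) (c : ℕ), ∀ (m d : ℕ), Even m → 2 ≤ m → 2 ≤ d →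
      MultipointEvaluationWithin F m d
        (softO K c (((d ^ (1 + m / 2) - 1) / (d - 1) * d ^ m +
          2 ^ (m / 2) * d ^ (m / 2 - 1) * d ^ m : ℕ) : ℝ)) := by
  obtain ⟨p, K, c, H⟩ := hF
  obtain ⟨K', c', hK⟩ := exists_softO_bound K c (A := ((p.eval 1 + 5 : ℕ) : ℝ))
    (by exact_mod_cast (by omega : 1 ≤ p.eval 1 + 5))
  refine ⟨K', c', fun m d hm hm2 hd => ?_⟩
  have hΔ := one_le_geomQuotient (m := m) hd
  have hdeg : ∀ (x : Fin (d ^ m) → Fin m → F) (i : Fin (d ^ m)) (j : Fin 2),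
      (annihilatorPoly x i j).support ⊆
        Finset.range (0 * (j : ℕ) + (d ^ (1 + m / 2) - 1) / (d - 1) + 1) := by
    intro x i j
    rw [zero_mul, zero_add, annihilatorPoly, add_comm 1]
    split_ifs
    · refine supp_subset_range (Nat.lt_succ_of_le ?_)
      exact natDegree_annihilator_le hd _ _
    · simp
  generalize (d ^ (1 + m / 2) - 1) / (d - 1) = Δ at hΔ hdeg ⊢
  obtain ⟨Q, hQ, hQc⟩ := H (d ^ m) 1 (2 ^ (m / 2) * d ^ (m / 2 - 1)) 0 Δ le_rfl (by omega)
  -- Degree at most `Δ` allows `Δ + 1` coefficients; the surplus is absorbed through `N ≤ Δ N`.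
  have hE := exists_evaluation_tree (D := Δ + 1) hd hm hm2 (fun _ _ => by simp) hdeg hQ
  refine hE.mono ?_
  rw [Nat.cast_add, Nat.cast_mul, Nat.cast_mul, Nat.cast_mul, Nat.cast_ofNat]
  have h3 : d ^ m ≤ Δ * d ^ m := Nat.le_mul_of_pos_left _ hΔ
  refine hK m d _ _ _ _ hm2 hd (by exact_mod_cast h3.trans (Nat.le_add_right _ _))
    (Nat.cast_nonneg _) ?_ (Nat.cast_nonneg _) ?_ hQc
  · rw [← Nat.cast_mul, Nat.cast_le, zero_add]
    generalize 2 ^ (m / 2) * d ^ (m / 2 - 1) * d ^ m = r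
    nlinarith [Nat.zero_le (p.eval 1 * r), Nat.zero_le (Δ * d ^ m)]
  · rw [← Nat.cast_mul, Nat.cast_le]
    generalize 2 ^ (m / 2) * d ^ (m / 2 - 1) * d ^ m = r
    nlinarith [Nat.zero_le (p.eval 1 * (Δ * d ^ m + r))]

end Consequences

theorem mainTheorem11 (F : Type u) [Field F] :
    -- the evaluation matrix satisfies a recurrence of small width and degree
    (∀ (m d : ℕ), Even m → 2 ≤ m → 2 ≤ d → ∀ x : Fin (d ^ m) → Fin m → F,
      SatisfiesRecurrence (shiftMatrix F (d ^ m)) 1 (2 ^ (m / 2) * d ^ (m / 2 - 1))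
          0 ((d ^ (1 + m / 2) - 1) / (d - 1)) (evalMatrix x) ∧
      ((∀ (k : Fin (d ^ m)) (j : Fin m), (j : ℕ) ≤ m / 2 → x k j.rev ≠ 0) →
        (displacedMatrix x).rank ≤ 2 ^ (m / 2) * d ^ (m / 2 - 1) ∧
        IsRecurrence (shiftMatrix F (d ^ m)) 1 (evalRecurrencePoly x) (displacedMatrix x)
          (evalMatrix x) ∧
        ∀ (k : Fin (d ^ m)) (j : ℕ),
          (evalRecurrencePoly x k j).natDegree ≤ (d ^ (1 + m / 2) - 1) / (d - 1) ∧
          (evalRecurrencePoly x k j).support.card ≤ 2 ^ (m / 2 + 1))) ∧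
    -- the consequence of faster multiplication, `D` being a bound on the sparsity
    (FastSparseMultiplication F →
      (∃ (K : ℝ) (c : ℕ), ∀ (m d : ℕ), Even m → 2 ≤ m → 2 ≤ d →
        MultipointEvaluationWithin F m d (softO K c ((2 * d : ℝ) ^ (3 * m / 2 - 1)))) ∧
      (∀ (m : ℕ) (w : ℝ), Even m → 2 ≤ m → 3 ≤ w →
        ∃ (ε K : ℝ), 0 < ε ∧ ∀ d : ℕ, 2 ≤ d →
          MultipointEvaluationWithin F m d (K * (d : ℝ) ^ (w * (m - 1) / 2 + 1 - ε)))) ∧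
    -- the consequence of faster multiplication, `D` being a bound on the degree
    (FastDegreeMultiplication F →
      (∃ (K : ℝ) (c : ℕ), ∀ (m d : ℕ), Even m → 2 ≤ m → 2 ≤ d →
        MultipointEvaluationWithin F m d
          (softO K c (((d ^ (1 + m / 2) - 1) / (d - 1) * d ^ m +
            2 ^ (m / 2) * d ^ (m / 2 - 1) * d ^ m : ℕ) : ℝ))) ∧
      (∀ (m : ℕ) (w : ℝ), Even m → 2 ≤ m → (3 * m / 2 : ℝ) < w * (m - 1) / 2 + 1 →
        ∃ (ε K : ℝ), 0 < ε ∧ ∀ d : ℕ, 2 ≤ d →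
          MultipointEvaluationWithin F m d (K * (d : ℝ) ^ (w * (m - 1) / 2 + 1 - ε)))) := by
  refine ⟨fun m d hm hm2 hd x => ⟨satisfiesRecurrence_evalMatrix hd hm hm2 x,
    displacedMatrix_recurrence hd hm hm2 x⟩, fun hF => ?_, fun hF => ?_⟩
  · obtain ⟨K, c, H⟩ := evaluation_of_fastSparse hF
    refine ⟨⟨K, c, H⟩, fun m w hm hm2 hw => ?_⟩
    refine exists_rpow_bound (a := ((3 * m / 2 - 1 : ℕ) : ℝ)) (C := 2 ^ (3 * m / 2 - 1))
      ?_ ?_ (fun d hd => ?_) (fun d hd => ?_) fun d hd => H m d hm hm2 hd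
    · exact_mod_cast (by omega : 0 < 3 * m / 2 - 1)
    -- For `w ≥ 3` the target exponent is at least `3m/2 - 1/2`, which exceeds `3m/2 - 1` by `1/2`.
    · obtain ⟨h, rfl⟩ := hm
      have h1 : 3 * (h + h) / 2 - 1 + 1 = 3 * h := by omega
      have h2 : ((3 * (h + h) / 2 - 1 : ℕ) : ℝ) + 1 = 3 * h := by exact_mod_cast h1
      have h3 : (1 : ℝ) ≤ h := by exact_mod_cast (by omega : 1 ≤ h)
      push_cast
      nlinarith
    · exact one_le_pow₀ (by linarith [(Nat.one_le_cast (α := ℝ)).2 (by omega : 1 ≤ d)])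
    · rw [mul_pow, Real.rpow_natCast]
  · obtain ⟨K, c, H⟩ := evaluation_of_fastDegree hF
    refine ⟨⟨K, c, H⟩, fun m w hm hm2 hw => ?_⟩
    -- `C` adds the bounds `ΔN ≤ 2 d^(3m/2)` and `rN ≤ 2^(m/2) d^(3m/2)`.
    refine exists_rpow_bound (a := (3 * m / 2 : ℝ)) (C := ((2 + 2 ^ (m / 2) : ℕ) : ℝ))
      (by positivity) hw (fun d hd => ?_) (fun d hd => ?_) fun d hd => H m d hm hm2 hd
    · have h1 := Nat.mul_le_mul (one_le_geomQuotient (m := m) hd) (Nat.one_le_pow m d (by omega))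
      exact_mod_cast (by omega : 1 ≤ (d ^ (1 + m / 2) - 1) / (d - 1) * d ^ m +
        2 ^ (m / 2) * d ^ (m / 2 - 1) * d ^ m)
    · have ha : (3 * m / 2 : ℝ) = ((3 * m / 2 : ℕ) : ℝ) := by
        obtain ⟨h, rfl⟩ := hm
        rw [show 3 * (h + h) / 2 = 3 * h by omega]
        push_cast
        ring
      rw [ha, Real.rpow_natCast]
      norm_cast
      rw [rank_mul_eq d hm hm2, add_mul]
      refine Nat.add_le_add ?_ (Nat.mul_le_mul_left _ (Nat.pow_le_pow_right (by omega) (by omega)))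
      refine (Nat.mul_le_mul_right _ (geomQuotient_le hd)).trans ?_
      rw [mul_assoc, ← pow_add]
      refine Nat.mul_le_mul_left _ (Nat.pow_le_pow_right (by omega) ?_)
      obtain ⟨h, rfl⟩ := hm
      omega
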